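/- Let $\mathcal F=\langle X_0,X_1,X_2,\ldots \mid X_i^{-1}X_jX_i=X_{j+1},\ i<j\rangle$ be Thompson's group, and let $\mathcal S\subseteq\mathcal F$ be Thompson's semigroup, i.e. the set of all products $X_0^{\alpha_0}X_1^{\alpha_1}\cdots X_n^{\alpha_n}$ with $n,\alpha_0,\ldots,\alpha_n\in\mathbb N=\{0,1,2,\ldots\}$; equivalently, the unital subsemigroup generated by $X_0,X_1,X_2,\ldots$. For $f,g\in l^2(\mathcal S)$ (complex valued) let $(f*g)(s)=\sum_{uv=s}f(u)g(v)$ for $s\in\mathcal S$. Let $\mathcal L(\mathcal S)$ be the space of all bounded left convolution operators on $l^2(\mathcal S)$, i.e. of all $T\in B(l^2(\mathcal S))$ for which there is $f\in l^2(\mathcal S)$ with $Tg=f*g$ for all $g\in l^2(\mathcal S)$. For $s\in\mathcal S$ let $L_s$ be the isometry $g\mapsto\delta_s*g$, and let $\mathfrak B(\mathcal S)\subseteq\mathcal L(\mathcal S)$ be the Banach algebra generated by $\{L_s: s\in\mathcal S\}$, i.e. the norm closure in $B(l^2(\mathcal S))$ of the algebra generated by these operators. Let $\mathcal Z^1$ be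 the space of all continuous derivations from $\mathfrak B(\mathcal S)$ into $\mathcal L(\mathcal S)$, i.e. of all continuous linear maps $D:\mathfrak B(\mathcal S)\to\mathcal L(\mathcal S)$ with $D(AB)=A\,D(B)+D(A)\,B$ for all $A,B\in\mathfrak B(\mathcal S)$, and let $\mathcal B^1\subseteq\mathcal Z^1$ be the subspace of inner derivations $A\mapsto AT-TA$ with $T\in\mathcal L(\mathcal S)$. Then the first continuous Hochschild cohomology group vanishes: $$H^1(\mathfrak B(\mathcal S),\mathcal L(\mathcal S))=\mathcal Z^1/\mathcal B^1=0.$$ That is, for every continuous derivation $D:\mathfrak B(\mathcal S)\to\mathcal L(\mathcal S)$ there is $C\in\mathcal L(\mathcal S)$ such that $D(T)=CT-TC$ for all $T\in\mathfrak B(\mathcal S)$. -/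

import Mathlib

noncomputable section

namespace Thompson

/-! ## Thompson's group and Thompson's semigroup -/

/-- The relators `X_i⁻¹ X_j X_i X_{j+1}⁻¹`, `i < j`, of Thompson's group. -/
def rels : Set (FreeGroup ℕ) :=
  {r | ∃ i j : ℕ, i < j ∧
    r = (FreeGroup.of i)⁻¹ * FreeGroup.of j * FreeGroup.of i * (FreeGroup.of (j + 1))⁻¹}

/-- Thompson's group `⟨X₀, X₁, X₂, … | X_i⁻¹ X_j X_i = X_{j+1}, i < j⟩`. -/
abbrev ThompsonGroup : Type := PresentedGroup rels

/-- The generators of Thompson's group. -/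
def X (n : ℕ) : ThompsonGroup := PresentedGroup.of n

/-- Thompson's semigroup: the unital subsemigroup of Thompson's group generated by
`X₀, X₁, X₂, …`. It consists of the products `X₀ ^ α₀ ⋯ X_{n-1} ^ α_{n-1}`
(see `mem_thompsonSemigroup_iff`). -/
def thompsonSemigroup : Submonoid ThompsonGroup := Submonoid.closure (Set.range X)

theorem X_mul_X {i j : ℕ} (h : i < j) : X j * X i = X i * X (j + 1) := by
  have h1 : (PresentedGroup.mk rels) ((FreeGroup.of i)⁻¹ * FreeGroup.of j * FreeGroup.of i *
      (FreeGroup.of (j + 1))⁻¹) = 1 :=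
    PresentedGroup.one_of_mem ⟨i, j, h, rfl⟩
  have h2 : (X i)⁻¹ * X j * X i * (X (j + 1))⁻¹ = 1 := by simpa [X, PresentedGroup.of] using h1
  rw [mul_inv_eq_one, mul_assoc, inv_mul_eq_iff_eq_mul] at h2
  exact h2

/-- The ordered product `X₀ ^ α₀ X₁ ^ α₁ ⋯ X_{n-1} ^ α_{n-1}`. -/
def ordProd (α : ℕ → ℕ) (n : ℕ) : ThompsonGroup := ((List.range n).map fun i => X i ^ α i).prod

theorem ordProd_succ (α : ℕ → ℕ) (n : ℕ) : ordProd α (n + 1) = ordProd α n * X n ^ α n := by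
  simp [ordProd, List.range_succ]

theorem ordProd_congr {α β : ℕ → ℕ} {n : ℕ} (h : ∀ i < n, α i = β i) :
    ordProd α n = ordProd β n := by
  induction n with
  | zero => rfl
  | succ n ih =>
    rw [ordProd_succ, ordProd_succ, ih fun i hi => h i (by omega), h n (by omega)]

theorem ordProd_mul_pow (α : ℕ → ℕ) (n m : ℕ) :
    ∃ β, ordProd α n * X n ^ m = ordProd β (n + 1) := by
  refine ⟨Function.update α n m, ?_⟩
  rw [ordProd_succ, Function.update_self]
  congr 1
  exact ordProd_congr fun i hi => (Function.update_of_ne hi.ne _ _).symm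

theorem ordProd_mul_X (α : ℕ → ℕ) (n k : ℕ) (hk : k ≤ n) :
    ∃ β, ordProd α n * X k = ordProd β (n + 1) := by
  induction n generalizing α with
  | zero =>
    obtain rfl : k = 0 := by omega
    simpa using ordProd_mul_pow α 0 1
  | succ n ih =>
    rcases Nat.lt_or_ge k (n + 1) with h | h
    · rcases Nat.lt_or_ge k n with h' | h'
      · have hpow : ∀ m : ℕ, X n ^ m * X k = X k * X (n + 1) ^ m := fun m =>
          (SemiconjBy.pow_right (show SemiconjBy (X k) (X (n + 1)) (X n) from
            (X_mul_X h').symm) m).symm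
        obtain ⟨β, hβ⟩ := ih α h'.le
        rw [ordProd_succ, mul_assoc, hpow, ← mul_assoc, hβ]
        exact ordProd_mul_pow _ _ _
      · obtain rfl : k = n := by omega
        rw [ordProd_succ, mul_assoc, ← pow_succ]
        obtain ⟨β, hβ⟩ := ordProd_mul_pow α k (α k + 1)
        rw [hβ]
        simpa using ordProd_mul_pow β (k + 1) 0
    · obtain rfl : k = n + 1 := by omega
      simpa using ordProd_mul_pow α (n + 1) 1

theorem mem_thompsonSemigroup_iff (x : ThompsonGroup) :
    x ∈ thompsonSemigroup ↔ ∃ (n : ℕ) (α : ℕ → ℕ), x = ordProd α n := by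
  constructor
  · intro hx
    refine Submonoid.closure_induction_right (motive := fun x _ => ∃ (n : ℕ) (α : ℕ → ℕ),
      x = ordProd α n) ⟨0, 0, rfl⟩ ?_ hx
    rintro _ _ _ ⟨k, rfl⟩ ⟨n, α, rfl⟩
    have hext : ∀ m, ∃ β, ordProd α n = ordProd β (n + m) := by
      intro m
      induction m with
      | zero => exact ⟨α, rfl⟩
      | succ m ih =>
        obtain ⟨β, hβ⟩ := ih
        rw [hβ]
        simpa [add_assoc] using ordProd_mul_pow β (n + m) 0
    obtain ⟨β, hβ⟩ := hext k
    obtain ⟨γ, hγ⟩ := ordProd_mul_X β (n + k) k (by omega)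
    exact ⟨_, γ, by rw [hβ, hγ]⟩
  · rintro ⟨n, α, rfl⟩
    refine Submonoid.list_prod_mem _ fun y hy => ?_
    obtain ⟨i, -, rfl⟩ := List.mem_map.1 hy
    exact pow_mem (Submonoid.subset_closure (Set.mem_range_self i)) _

/-! ## Convolution operators on `ℓ²(S)` -/

/-- The Hilbert space `ℓ²(S)`. -/
abbrev L2 (S : Type*) : Type _ := lp (fun _ : S => ℂ) 2

/-- The vector `δ_s`. -/
def delta {S : Type*} (s : S) : L2 S := by
  classical exact lp.single 2 s 1

/-- Convolution `(f * g)(s) = ∑_{uv = s} f(u) g(v)`. -/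
def conv {S : Type*} [Monoid S] (f g : L2 S) (s : S) : ℂ :=
  ∑' p : {p : S × S // p.1 * p.2 = s}, f p.1.1 * g p.1.2

/-- `T` is the left convolution operator `L_f`. -/
def IsLeftConv {S : Type*} [Monoid S] (f : L2 S) (T : L2 S →L[ℂ] L2 S) : Prop :=
  ∀ (g : L2 S) (s : S), T g s = conv f g s

theorem summable_sq {S : Type*} (f : L2 S) : Summable fun s => ‖f s‖ ^ (2 : ℝ) := by
  simpa using (lp.memℓp f).summable (by norm_num)

theorem summable_conv {S : Type*} [Monoid S] [IsCancelMul S] (f g : L2 S) (s : S) :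
    Summable fun p : {p : S × S // p.1 * p.2 = s} => f p.1.1 * g p.1.2 := by
  have h1 : Function.Injective fun p : {p : S × S // p.1 * p.2 = s} => p.1.1 := by
    rintro ⟨⟨a, b⟩, h⟩ ⟨⟨c, d⟩, h'⟩ (rfl : a = c)
    obtain rfl : b = d := mul_left_cancel (h.trans h'.symm)
    rfl
  have h2 : Function.Injective fun p : {p : S × S // p.1 * p.2 = s} => p.1.2 := by
    rintro ⟨⟨a, b⟩, h⟩ ⟨⟨c, d⟩, h'⟩ (rfl : b = d)
    obtain rfl : a = c := mul_right_cancel (h.trans h'.symm)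
    rfl
  refine Summable.of_norm ?_
  simp only [norm_mul]
  exact Real.summable_mul_of_Lp_Lq_of_nonneg (Real.HolderConjugate.two_two) (fun _ => norm_nonneg _)
    (fun _ => norm_nonneg _) ((summable_sq f).comp_injective h1)
    ((summable_sq g).comp_injective h2)

theorem conv_delta_mul {S : Type*} [Monoid S] [IsCancelMul S] (s : S) (g : L2 S) (x : S) :
    conv (delta s) g (s * x) = g x := by
  classical
  rw [conv, tsum_eq_single ⟨(s, x), rfl⟩]
  · simp [delta]
  · rintro ⟨⟨u, v⟩, h⟩ hne
    have : u ≠ s := by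
      rintro rfl
      obtain rfl : v = x := mul_left_cancel h
      exact hne rfl
    simp [delta, this]

theorem conv_delta_of_notMem {S : Type*} [Monoid S] [IsCancelMul S] (s : S) (g : L2 S) (y : S)
    (hy : y ∉ Set.range (s * ·)) : conv (delta s) g y = 0 := by
  classical
  refine (tsum_congr ?_).trans tsum_zero
  rintro ⟨⟨u, v⟩, h⟩
  have : u ≠ s := by
    rintro rfl
    exact hy ⟨v, h⟩
  simp [delta, this]

theorem hasSum_norm_conv_delta {S : Type*} [Monoid S] [IsCancelMul S] (s : S) (g : L2 S) :
    HasSum (fun y => ‖conv (delta s) g y‖ ^ (2 : ℝ)) (‖g‖ ^ (2 : ℝ)) := by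
  have hinj : Function.Injective (s * · : S → S) := mul_right_injective s
  rw [← hinj.hasSum_iff fun y hy => by simp [conv_delta_of_notMem s g y hy]]
  simpa [Function.comp_def, conv_delta_mul] using lp.hasSum_norm (p := 2) (by norm_num) g

/-- The isometry `L_s = L_{δ_s}` on `ℓ²(S)`, for a cancellative `S`: `s ↦ L_s` is the left
regular representation. -/
def leftReg {S : Type*} [Monoid S] [IsCancelMul S] (s : S) : L2 S →ₗᵢ[ℂ] L2 S where
  toFun g := ⟨conv (delta s) g, memℓp_gen (by
    simpa using (hasSum_norm_conv_delta s g).summable)⟩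
  map_add' g h := by
    ext x
    change conv _ _ x = conv _ _ x + conv _ _ x
    rw [conv, conv, conv, ← (summable_conv _ g x).tsum_add (summable_conv _ h x)]
    simp [mul_add]
  map_smul' c g := by
    ext x
    change conv _ _ x = c * conv _ _ x
    rw [conv, conv, ← tsum_mul_left]
    simp [mul_left_comm]
  norm_map' g := by
    have h := lp.hasSum_norm (p := 2) (by norm_num)
      (⟨conv (delta s) g, memℓp_gen (by
        simpa using (hasSum_norm_conv_delta s g).summable)⟩ : L2 S)
    have h' := h.unique (by simpa using hasSum_norm_conv_delta s g)
    exact (Real.rpow_left_inj (z := 2) (norm_nonneg _) (norm_nonneg _) (by norm_num)).1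
      (by simpa using h')

/-- The Banach algebra `𝔅(S)`: the norm closed subalgebra of `B(ℓ²(S))` generated by the left
regular representation. -/
def regAlg (S : Type*) [Monoid S] [IsCancelMul S] : Subalgebra ℂ (L2 S →L[ℂ] L2 S) :=
  (Algebra.adjoin ℂ (Set.range fun s : S => (leftReg s).toContinuousLinearMap)).topologicalClosure

/-- The space `ℒ(S)` of all bounded left convolution operators `L_f`, `f ∈ ℓ²(S)`. -/
def convAlg (S : Type*) [Monoid S] [IsCancelMul S] : Submodule ℂ (L2 S →L[ℂ] L2 S) where
  carrier := {T | ∃ f : L2 S, IsLeftConv f T}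
  zero_mem' := ⟨0, fun g s => by simp [conv]⟩
  add_mem' := by
    rintro T U ⟨f, hf⟩ ⟨f', hf'⟩
    refine ⟨f + f', fun g s => ?_⟩
    change T g s + U g s = _
    rw [hf, hf', conv, conv, conv, ← (summable_conv f g s).tsum_add (summable_conv f' g s)]
    simp [add_mul]
  smul_mem' := by
    rintro c T ⟨f, hf⟩
    refine ⟨c • f, fun g s => ?_⟩
    change c * T g s = _
    rw [hf, conv, conv, ← tsum_mul_left]
    simp [mul_assoc]

/-! ## First continuous Hochschild cohomology -/

section Cohomology

variable {A : Type*} [NormedRing A] [NormedAlgebra ℂ A]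

/-- `𝒵¹(𝔅, 𝔏)`: the continuous derivations from a subalgebra `𝔅` into a linear
subspace `𝔏` of a Banach algebra, the module products being those of that algebra. -/
def Z1 (B : Subalgebra ℂ A) (L : Submodule ℂ A) :
    Submodule ℂ (B →L[ℂ] L) where
  carrier := {D | ∀ S T : B, (D (S * T) : A) = S * D T + D S * T}
  zero_mem' := fun S T => by simp
  add_mem' := by
    intro D E hD hE S T
    have h1 := hD S T
    have h2 := hE S T
    simp only [add_apply, Submodule.coe_add, h1, h2, mul_add, add_mul]
    abel
  smul_mem' := by
    intro c D hD S T
    have h1 := hD S T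
    simp only [smul_apply, Submodule.coe_smul, h1, smul_add, mul_smul_comm, smul_mul_assoc]

/-- `ℬ¹(𝔅, 𝔏)`: the inner derivations `T ↦ T C - C T` with `C ∈ 𝔏`. -/
def B1 (B : Subalgebra ℂ A) (L : Submodule ℂ A) :
    Submodule ℂ (B →L[ℂ] L) where
  carrier := {D | ∃ C ∈ L, ∀ T : B, (D T : A) = T * C - C * T}
  zero_mem' := ⟨0, L.zero_mem, fun T => by simp⟩
  add_mem' := by
    rintro D E ⟨C, hC, hD⟩ ⟨C', hC', hE⟩
    refine ⟨C + C', L.add_mem hC hC', fun T => ?_⟩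
    simp only [add_apply, Submodule.coe_add, hD, hE, mul_add, add_mul]
    abel
  smul_mem' := by
    rintro c D ⟨C, hC, hD⟩
    refine ⟨c • C, L.smul_mem c hC, fun T => ?_⟩
    simp only [smul_apply, Submodule.coe_smul, hD, smul_sub, mul_smul_comm,
      smul_mul_assoc]

theorem B1_le_Z1 (B : Subalgebra ℂ A) (L : Submodule ℂ A) :
    B1 B L ≤ Z1 B L := by
  rintro D ⟨C, -, hD⟩ S T
  rw [hD, hD, hD]
  push_cast
  noncomm_ring

/-- The first continuous Hochschild cohomology group `H¹(𝔅, 𝔏) = 𝒵¹(𝔅, 𝔏) / ℬ¹(𝔅, 𝔏)`, as the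
quotient of additive groups. -/
abbrev H1 (B : Subalgebra ℂ A) (L : Submodule ℂ A) : Type _ :=
  (Z1 B L).toAddSubgroup ⧸ (B1 B L).toAddSubgroup.addSubgroupOf (Z1 B L).toAddSubgroup

end Cohomology

end Thompson

end

/-!
Write `G` for Thompson's group, `S` for its semigroup, and let `D` be a continuous derivation. Let
`f_s` be the symbol of `D (L_s)`. The derivation rule makes `φ_s = f_s * δ_{s⁻¹}`, viewed in
`ℓ²(G)`, a bounded cocycle for the conjugation action: `φ_{st} = φ_s + δ_s * φ_t * δ_{s⁻¹}`.
Hence each affine isometry `v ↦ δ_s * v * δ_{s⁻¹} + φ_s` maps the bounded set of all `φ_t` into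
itself, so it fixes the circumcenter `c` of that set (`exists_mem_closedConvexHull_fixed`), and
`f_s = c * δ_s - δ_s * c` (`exists_coboundary`). It remains to see that `c` is the symbol of
an operator in `ℒ(S)`.

* Boundedness. Every finite subset of `G` has a common right denominator in `S`, so convolution
  by `f_s` is as bounded on finitely supported functions on `G` as it is on `ℓ²(S)`. The bound
  passes from the `φ_s` to their closed convex hull, which contains `c`
  (`norm_sum_smul_rightTrans_le`).
* Support. If `h * s ∉ S`, then `f_s` vanishes at `h * s`, so `c h = c (s⁻¹ * h * s)`. For `h ∉ S`
  there are infinitely many such conjugates (`infinite_conj`), and a square summable function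
  takes a nonzero value only finitely often, so `c h = 0`.

The conjugates are found through an action of `G` on `ℚ` by piecewise linear maps, in which `s ∈ S`
maps each interval `[n, n + 1]` affinely onto a standard dyadic interval: these intervals are the
leaves of the forest that represents `s`. Right divisibility by `X i` means that the leaves `i` and
`i + 1` form a caret, which is visible in the action (`mul_X_inv_mem`). For `h ∉ S` there
are `d ∈ S` and `i` with `h * d ∉ S` and `h * d * X i ∈ S`, and then `h * d * X j ^ n ∉ S` for all
`j ≠ i` and all `n`. Were the conjugates by the elements `d * X j ^ n` finite in number,
`k = d⁻¹ * h * d` would commute with a power of each `X j`, `j ≠ i`. It would then fix `i` and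
`i + 1`, so that the leaves `i` and `i + 1` of `h * d * X i` would form a caret, contradicting
`h * d ∉ S`.
-/

noncomputable section

namespace Thompson

open Filter Topology

/-! ### Fractions in Thompson's group -/

theorem X_mem (i : ℕ) : X i ∈ thompsonSemigroup := Submonoid.subset_closure ⟨i, rfl⟩

theorem thompsonSemigroup_induction_right {p : ThompsonGroup → Prop} (one : p 1)
    (mul : ∀ t ∈ thompsonSemigroup, ∀ i, p t → p (t * X i)) {s : ThompsonGroup}
    (hs : s ∈ thompsonSemigroup) : p s := by
  refine Submonoid.closure_induction_right (motive := fun x _ => p x) one ?_ hs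
  rintro t ht _ ⟨i, rfl⟩ h
  exact mul t ht i h

theorem closure_range_X : Subgroup.closure (Set.range X) = ⊤ :=
  PresentedGroup.closure_range_of rels

theorem X_inv_mul_X_of_lt {i j : ℕ} (h : i < j) : (X i)⁻¹ * X j = X (j + 1) * (X i)⁻¹ := by
  rw [inv_mul_eq_iff_eq_mul, ← mul_assoc, ← X_mul_X h, mul_inv_cancel_right]

theorem X_inv_mul_X_of_gt {i j : ℕ} (h : j < i) : (X i)⁻¹ * X j = X j * (X (i + 1))⁻¹ := by
  rw [inv_mul_eq_iff_eq_mul, ← mul_assoc, X_mul_X h, mul_inv_cancel_right]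

/-- The Ore condition: each `a` in the semigroup has a common right multiple with `X i`. -/
theorem exists_mul_eq_X_mul {a : ThompsonGroup} (ha : a ∈ thompsonSemigroup) (i : ℕ) :
    ∃ u ∈ thompsonSemigroup, (X i)⁻¹ * (a * u) ∈ thompsonSemigroup := by
  revert i
  refine Submonoid.closure_induction_left (motive := fun a _ => ∀ i, ∃ u ∈ thompsonSemigroup,
    (X i)⁻¹ * (a * u) ∈ thompsonSemigroup) ?_ ?_ ha
  · exact fun i => ⟨X i, X_mem i, by simp [one_mem]⟩
  · rintro _ ⟨q, rfl⟩ a ha ih i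
    rcases lt_trichotomy i q with h | rfl | h
    · obtain ⟨u, hu, hw⟩ := ih i
      refine ⟨u, hu, ?_⟩
      have : (X i)⁻¹ * (X q * a * u) = X (q + 1) * ((X i)⁻¹ * (a * u)) := by
        rw [← mul_assoc (X (q + 1)), ← X_inv_mul_X_of_lt h]
        group
      rw [this]
      exact mul_mem (X_mem _) hw
    · exact ⟨1, one_mem _, by
        rw [mul_one, inv_mul_cancel_left]
        exact ha⟩
    · obtain ⟨u, hu, hw⟩ := ih (i + 1)
      refine ⟨u, hu, ?_⟩
      have : (X i)⁻¹ * (X q * a * u) = X q * ((X (i + 1))⁻¹ * (a * u)) := by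
        rw [← mul_assoc (X q), ← X_inv_mul_X_of_gt h]
        group
      rw [this]
      exact mul_mem (X_mem _) hw

/-- Thompson's group consists of the right fractions `a * b⁻¹` of elements of the semigroup. -/
theorem exists_mul_mem (g : ThompsonGroup) :
    ∃ b ∈ thompsonSemigroup, g * b ∈ thompsonSemigroup := by
  have hg : g ∈ Subgroup.closure (Set.range X) := closure_range_X ▸ Subgroup.mem_top g
  refine Subgroup.closure_induction_left (p := fun g _ => ∃ b ∈ thompsonSemigroup,
    g * b ∈ thompsonSemigroup) ⟨1, one_mem _, by simp [one_mem]⟩ ?_ ?_ hg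
  · rintro _ ⟨i, rfl⟩ g - ⟨b, hb, h⟩
    exact ⟨b, hb, by rw [mul_assoc]; exact mul_mem (X_mem i) h⟩
  · rintro _ ⟨i, rfl⟩ g - ⟨b, hb, h⟩
    obtain ⟨u, hu, hw⟩ := exists_mul_eq_X_mul h i
    exact ⟨b * u, mul_mem hb hu, by simpa [mul_assoc] using hw⟩

/-! ### The piecewise linear action -/

/-- The order automorphism of `ℚ` that fixes `t ≤ i`, halves distances on `[i, i + 2]`, and
translates by `-1` on `t ≥ i + 2`. -/
def halve (i : ℕ) : ℚ ≃o ℚ where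
  toFun t := max (min t ((t + i) / 2)) (t - 1)
  invFun t := min (max t (2 * t - i)) (t + 1)
  left_inv t := by grind
  right_inv t := by grind
  map_rel_iff' {s t} := by
    simp only [Equiv.coe_fn_mk]
    grind

theorem halve_apply (i : ℕ) (t : ℚ) : halve i t = max (min t ((t + i) / 2)) (t - 1) := rfl

theorem halve_of_le {i : ℕ} {t : ℚ} (h : t ≤ i) : halve i t = t := by
  rw [halve_apply]; grind

theorem halve_of_mem {i : ℕ} {t : ℚ} (h : i ≤ t) (h' : t ≤ i + 2) : halve i t = (t + i) / 2 := by
  rw [halve_apply]; grind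

theorem halve_of_ge {i : ℕ} {t : ℚ} (h : i + 2 ≤ t) : halve i t = t - 1 := by
  rw [halve_apply]; grind

theorem halve_le (i : ℕ) (t : ℚ) : halve i t ≤ t := by
  rw [halve_apply]; grind

theorem halve_lt {i : ℕ} {t : ℚ} (h : i < t) : halve i t < t := by
  rw [halve_apply]; grind

theorem halve_mul_halve {i j : ℕ} (h : i < j) :
    halve j * halve i = halve i * halve (j + 1) := by
  have : (i : ℚ) + 1 ≤ j := by exact_mod_cast h
  ext t
  simp only [RelIso.mul_apply, halve_apply]
  push_cast
  grind

/-- Thompson's group acting on `ℚ` by piecewise linear maps: the generator `X i` acts by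
`halve i`, so that an element of the semigroup maps each interval `[n, n + 1]` affinely onto a
standard dyadic interval. -/
def act : ThompsonGroup →* (ℚ ≃o ℚ) :=
  PresentedGroup.toGroup (f := halve) (rels := rels) <| by
    rintro _ ⟨i, j, h, rfl⟩
    simp only [map_mul, map_inv, FreeGroup.lift_apply_of]
    rw [mul_inv_eq_one, mul_assoc, inv_mul_eq_iff_eq_mul, halve_mul_halve h]

@[simp]
theorem act_X (i : ℕ) : act (X i) = halve i := PresentedGroup.toGroup.of _

theorem act_mul_apply (g h : ThompsonGroup) (t : ℚ) : act (g * h) t = act g (act h t) := by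
  rw [map_mul, RelIso.mul_apply]

theorem act_X_pow_of_le {j : ℕ} {t : ℚ} (h : t ≤ j) (n : ℕ) : act (X j ^ n) t = t := by
  induction n with
  | zero => simp
  | succ n ih => rw [pow_succ, act_mul_apply, act_X, halve_of_le h, ih]

theorem act_X_pow_lt {j n : ℕ} {t : ℚ} (h : j < t) (hn : n ≠ 0) : act (X j ^ n) t < t := by
  obtain ⟨n, rfl⟩ := Nat.exists_eq_succ_of_ne_zero hn
  clear hn
  induction n with
  | zero => simpa using halve_lt h
  | succ n ih =>
    rw [Nat.succ_eq_add_one, pow_succ', act_mul_apply, act_X]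
    exact (halve_le _ _).trans_lt ih

theorem act_X_pow_add {j n : ℕ} {t : ℚ} (h : j + 1 ≤ t) : act (X j ^ n) (t + n) = t := by
  induction n with
  | zero => simp
  | succ n ih =>
    rw [pow_succ, act_mul_apply, act_X, halve_of_ge (by push_cast; linarith),
      show t + ((n + 1 : ℕ) : ℚ) - 1 = t + n by push_cast; ring, ih]

theorem act_zero (g : ThompsonGroup) : act g 0 = 0 := by
  have hg : g ∈ Subgroup.closure (Set.range X) := closure_range_X ▸ Subgroup.mem_top g
  induction hg using Subgroup.closure_induction with
  | mem x hx =>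
    obtain ⟨i, rfl⟩ := hx
    rw [act_X, halve_of_le (by positivity)]
  | one => simp
  | mul x y _ _ hx hy => rw [act_mul_apply, hy, hx]
  | inv x _ hx => rw [← (act x).injective.eq_iff, ← act_mul_apply, mul_inv_cancel, hx]; simp

/-- An element of the semigroup maps each unit interval affinely onto a standard dyadic
interval. -/
theorem exists_act_add {s : ThompsonGroup} (hs : s ∈ thompsonSemigroup) (n : ℕ) :
    ∃ m r : ℕ, ∀ u : ℚ, 0 ≤ u → u ≤ 1 → act s (n + u) = (m + u) / 2 ^ r := by
  revert n
  refine thompsonSemigroup_induction_right (p := fun s => ∀ n : ℕ, ∃ m r : ℕ, ∀ u : ℚ, 0 ≤ u →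
    u ≤ 1 → act s (n + u) = (m + u) / 2 ^ r) (fun n => ⟨n, 0, by simp⟩) ?_ hs
  intro t _ q ih n
  simp only [act_mul_apply, act_X]
  rcases lt_trichotomy n q with h | rfl | h
  · have : (n : ℚ) + 1 ≤ q := by exact_mod_cast h
    obtain ⟨m, r, H⟩ := ih n
    exact ⟨m, r, fun u h0 h1 => by rw [halve_of_le (by linarith), H u h0 h1]⟩
  · obtain ⟨m, r, H⟩ := ih n
    refine ⟨2 * m, r + 1, fun u h0 h1 => ?_⟩
    rw [halve_of_mem (by linarith) (by linarith), show ((n : ℚ) + u + n) / 2 = n + u / 2 by ring,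
      H _ (by linarith) (by linarith)]
    push_cast
    field_simp
    ring
  · rcases Nat.eq_or_lt_of_le h with h | h
    · obtain rfl : n = q + 1 := h.symm
      obtain ⟨m, r, H⟩ := ih q
      refine ⟨2 * m + 1, r + 1, fun u h0 h1 => ?_⟩
      push_cast
      rw [halve_of_mem (by linarith) (by linarith),
        show ((q : ℚ) + 1 + u + q) / 2 = q + (1 + u) / 2 by ring,
        H _ (by linarith) (by linarith)]
      field_simp
      ring
    · obtain ⟨n, rfl⟩ : ∃ k, n = k + 1 := ⟨n - 1, by omega⟩
      have : (q : ℚ) + 1 ≤ n := by exact_mod_cast (show q + 1 ≤ n by omega)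
      obtain ⟨m, r, H⟩ := ih n
      refine ⟨m, r, fun u h0 h1 => ?_⟩
      push_cast
      rw [halve_of_ge (by linarith), ← H u h0 h1]
      congr 1
      ring

/-- `x` and `y` are the endpoints of a standard dyadic interval `[m / 2 ^ r, (m + 1) / 2 ^ r]`. -/
def IsStdDyadic (x y : ℚ) : Prop := ∃ m r : ℕ, x = m / 2 ^ r ∧ y = (m + 1) / 2 ^ r

theorem isStdDyadic_act {s : ThompsonGroup} (hs : s ∈ thompsonSemigroup) (n : ℕ) :
    IsStdDyadic (act s n) (act s (n + 1)) := by
  obtain ⟨m, r, H⟩ := exists_act_add hs n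
  exact ⟨m, r, by simpa using H 0 le_rfl zero_le_one, H 1 zero_le_one le_rfl⟩

/-- A fraction with odd numerator is in lowest terms among the dyadic ones. -/
theorem le_of_odd_div_eq {m M r R : ℕ}
    (h : ((2 * m + 1 : ℕ) : ℚ) / 2 ^ (r + 1) = (M : ℚ) / 2 ^ R) : r + 1 ≤ R := by
  by_contra! hlt
  obtain ⟨k, hk⟩ : ∃ k, r + 1 = R + (k + 1) := ⟨r - R, by omega⟩
  rw [hk, div_eq_div_iff (by positivity) (by positivity)] at h
  have h' : (2 * m + 1) * 2 ^ R = M * 2 ^ (R + (k + 1)) := by exact_mod_cast h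
  have h2 : 2 ^ R * (2 * m + 1) = 2 ^ R * (2 * (M * 2 ^ k)) := by
    rw [mul_comm, h']
    ring
  have h3 := Nat.eq_of_mul_eq_mul_left (by positivity) h2
  omega

/-- Two leaves of a forest that together span a standard dyadic interval form a caret: if
`s` maps `[i, i + 2]` onto a standard dyadic interval, then `s` is right divisible by `X i`. -/
theorem mul_X_inv_mem {s : ThompsonGroup} (hs : s ∈ thompsonSemigroup) {i : ℕ}
    (h : IsStdDyadic (act s i) (act s (i + 2))) : s * (X i)⁻¹ ∈ thompsonSemigroup := by
  revert i
  refine thompsonSemigroup_induction_right (p := fun s => ∀ {i : ℕ}, IsStdDyadic (act s i)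
    (act s (i + 2)) → s * (X i)⁻¹ ∈ thompsonSemigroup) ?_ ?_ hs
  · rintro i ⟨m, r, h1, h2⟩
    simp only [map_one, RelIso.one_apply] at h1 h2
    have h3 : (2 : ℚ) = 1 / 2 ^ r := by
      rw [add_div] at h2
      linarith
    have h4 : (1 : ℚ) / 2 ^ r ≤ 1 := by
      rw [div_le_one (by positivity)]
      exact one_le_pow₀ (by norm_num)
    linarith
  · intro t ht q ih i h
    simp only [act_mul_apply, act_X] at h
    rcases lt_trichotomy q i with hq | rfl | hq
    · rcases Nat.eq_or_lt_of_le hq with hq | hq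
      · -- The image of `[i, i + 2]` begins in the middle of the standard interval `t [q, q + 1]`
        -- and ends beyond it, which a standard dyadic interval cannot do.
        exfalso
        obtain rfl : i = q + 1 := hq.symm
        obtain ⟨m, r, H⟩ := exists_act_add ht q
        obtain ⟨M, R, h1, h2⟩ := h
        push_cast at h1 h2
        rw [halve_of_mem (by linarith) (by linarith),
          show ((q : ℚ) + 1 + q) / 2 = q + 1 / 2 by ring, H _ (by norm_num) (by norm_num)] at h1
        rw [halve_of_ge (by linarith)] at h2
        have hR : r + 1 ≤ R := le_of_odd_div_eq (m := m) (M := M) (by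
          rw [← h1]; push_cast; field_simp; ring)
        have hlt : act t (q + 1) < act t (q + 1 + 2 - 1) := (act t).strictMono (by linarith)
        rw [h2, H 1 (by norm_num) (by norm_num), add_div (M : ℚ), ← h1] at hlt
        have hle : (1 : ℚ) / 2 ^ R ≤ 1 / 2 ^ (r + 1) :=
          one_div_le_one_div_of_le (by positivity) (pow_le_pow_right₀ (by norm_num) hR)
        have : ((m : ℚ) + 1) / 2 ^ r = (m + 1 / 2) / 2 ^ r + 1 / 2 ^ (r + 1) := by
          field_simp; ring
        linarith
      · obtain ⟨i, rfl⟩ : ∃ k, i = k + 1 := ⟨i - 1, by omega⟩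
        have hqi : (q : ℚ) + 1 ≤ i := by exact_mod_cast (show q + 1 ≤ i by omega)
        push_cast at h
        rw [halve_of_ge (by linarith), halve_of_ge (by linarith),
          show (i : ℚ) + 1 + 2 - 1 = i + 2 by ring, show (i : ℚ) + 1 - 1 = i by ring] at h
        have h1 := ih h
        have h2 : t * X q * (X (i + 1))⁻¹ = t * (X i)⁻¹ * X q := by
          rw [mul_inv_eq_iff_eq_mul, mul_assoc, mul_assoc, ← X_mul_X (by omega)]
          group
        rw [h2]
        exact mul_mem h1 (X_mem q)
    · simpa using ht
    · rcases Nat.eq_or_lt_of_le hq with hq | hq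
      · -- The image of `[i, i + 2]` ends in the middle of `t [q, q + 1]` and begins before it.
        exfalso
        obtain rfl : q = i + 1 := hq.symm
        obtain ⟨m, r, H⟩ := exists_act_add ht (i + 1)
        obtain ⟨M, R, h1, h2⟩ := h
        push_cast at H
        rw [halve_of_le (by push_cast; linarith)] at h1
        rw [halve_of_mem (by push_cast; linarith) (by push_cast; linarith), Nat.cast_add,
          Nat.cast_one, show ((i : ℚ) + 2 + (i + 1)) / 2 = i + 1 + 1 / 2 by ring,
          H _ (by norm_num) (by norm_num)] at h2
        have hR : r + 1 ≤ R := le_of_odd_div_eq (m := m) (M := M + 1) (by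
          push_cast; rw [← h2]; field_simp; ring)
        have hlt : act t i < act t (i + 1) := (act t).strictMono (by linarith)
        have h3 := H 0 (by norm_num) (by norm_num)
        rw [add_zero, add_zero] at h3
        rw [add_div (M : ℚ), ← h1] at h2
        have hle : (1 : ℚ) / 2 ^ R ≤ 1 / 2 ^ (r + 1) :=
          one_div_le_one_div_of_le (by positivity) (pow_le_pow_right₀ (by norm_num) hR)
        have : (m : ℚ) / 2 ^ r = (m + 1 / 2) / 2 ^ r - 1 / 2 ^ (r + 1) := by
          field_simp; ring
        linarith
      · obtain ⟨q, rfl⟩ : ∃ k, q = k + 1 := ⟨q - 1, by omega⟩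
        have hqi : (i : ℚ) + 1 ≤ q := by exact_mod_cast (show i + 1 ≤ q by omega)
        rw [halve_of_le (by push_cast; linarith), halve_of_le (by push_cast; linarith)] at h
        have h1 := ih h
        have h2 : t * X (q + 1) * (X i)⁻¹ = t * (X i)⁻¹ * X q := by
          rw [mul_inv_eq_iff_eq_mul, mul_assoc, mul_assoc, X_mul_X (by omega)]
          group
        rw [h2]
        exact mul_mem h1 (X_mem _)

/-! ### Conjugates of elements outside the semigroup -/

/-- For `j ≠ i`, the power `X j ^ n` maps some unit interval onto `[i, i + 1]` by a translation. -/
theorem exists_act_X_pow_eq {i j : ℕ} (h : j ≠ i) (n : ℕ) :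
    ∃ p : ℕ, act (X j ^ n) p = i ∧ act (X j ^ n) (p + 1) = i + 1 := by
  rcases h.lt_or_gt with h | h
  · have h' : (j : ℚ) + 1 ≤ i := by exact_mod_cast h
    refine ⟨i + n, ?_, ?_⟩
    · push_cast
      exact act_X_pow_add h'
    · push_cast
      rw [add_right_comm]
      exact act_X_pow_add (by linarith)
  · have h' : (i : ℚ) + 1 ≤ j := by exact_mod_cast h
    exact ⟨i, act_X_pow_of_le (by linarith) n, act_X_pow_of_le h' n⟩

theorem mul_X_inv_mul_pow_notMem {a : ThompsonGroup} (ha : a ∈ thompsonSemigroup) {i j : ℕ}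
    (h : a * (X i)⁻¹ ∉ thompsonSemigroup) (hij : j ≠ i) (n : ℕ) :
    a * (X i)⁻¹ * X j ^ n ∉ thompsonSemigroup := by
  intro hw
  refine h (mul_X_inv_mem ha ?_)
  obtain ⟨p, h1, h2⟩ := exists_act_X_pow_eq hij n
  have h3 : ∀ t : ℚ, act (a * (X i)⁻¹) (halve i t) = act a t := fun t => by
    rw [← act_X, ← act_mul_apply, inv_mul_cancel_right]
  have := isStdDyadic_act hw p
  rw [act_mul_apply, act_mul_apply _ (X j ^ n), h1, h2] at this
  rw [← h3, ← h3, halve_of_mem (by linarith) (by linarith), halve_of_mem (by linarith) le_rfl]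
  convert this using 2 <;> ring

/-- The fixed points of `X j ^ n` are the `t ≤ j`, so an order automorphism commuting with it
fixes `j`. -/
theorem act_eq_of_commute_X_pow {k : ThompsonGroup} {j n : ℕ} (hn : n ≠ 0)
    (h : Commute k (X j ^ n)) : act k j = j := by
  have key : ∀ k : ThompsonGroup, Commute k (X j ^ n) → act k j ≤ j := by
    intro k hk
    by_contra! hlt
    have h1 := act_X_pow_lt hlt hn
    rw [← act_mul_apply, ← hk.eq, act_mul_apply, act_X_pow_of_le le_rfl] at h1
    exact h1.false
  refine (key k h).antisymm ?_
  have h2 := (act k).monotone (key k⁻¹ h.inv_left)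
  rwa [← act_mul_apply, mul_inv_cancel, map_one, RelIso.one_apply] at h2

/-- If `k` commutes with a power of each generator other than `X i`, then its action fixes
both `i` and `i + 1`. -/
theorem act_eq_of_commute {k : ThompsonGroup} {i : ℕ}
    (h : ∀ j ≠ i, ∃ n ≠ 0, Commute k (X j ^ n)) : act k i = i ∧ act k (i + 1) = i + 1 := by
  have hfix : ∀ j, i < j → act k j = j := fun j hj => by
    obtain ⟨n, hn, hk⟩ := h j hj.ne'
    exact act_eq_of_commute_X_pow hn hk
  refine ⟨?_, by exact_mod_cast hfix (i + 1) (Nat.lt_succ_self i)⟩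
  rcases Nat.eq_zero_or_pos i with rfl | hi
  · exact_mod_cast act_zero k
  · -- `X 0 ^ n` translates a point `i + n`, which `k` fixes, to `i`.
    obtain ⟨n, hn, hk⟩ := h 0 hi.ne
    have h1 : act (X 0 ^ n) (i + n) = i :=
      act_X_pow_add (by push_cast; rw [zero_add]; exact_mod_cast hi)
    have h2 : act k (i + n) = i + n := by exact_mod_cast hfix (i + n) (by omega)
    calc act k i = act (k * X 0 ^ n) (i + n) := by rw [act_mul_apply, h1]
      _ = i := by rw [hk.eq, act_mul_apply, h2, h1]

/-- An element outside the semigroup has infinitely many conjugates `s⁻¹ * h * s` by those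
elements `s` of the semigroup for which `h * s` is still outside. -/
theorem infinite_conj {h : ThompsonGroup} (hh : h ∉ thompsonSemigroup) :
    {x | ∃ s ∈ thompsonSemigroup, h * s ∉ thompsonSemigroup ∧ s⁻¹ * h * s = x}.Infinite := by
  intro hfin
  obtain ⟨b, hb, hab⟩ := exists_mul_mem h
  obtain ⟨d, hd, i, hdn, hdi⟩ : ∃ d ∈ thompsonSemigroup, ∃ i, h * d ∉ thompsonSemigroup ∧
      h * d * X i ∈ thompsonSemigroup := by
    revert hab
    refine thompsonSemigroup_induction_right (p := fun b => h * b ∈ thompsonSemigroup →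
      ∃ d ∈ thompsonSemigroup, ∃ i, h * d ∉ thompsonSemigroup ∧
      h * d * X i ∈ thompsonSemigroup) (fun h1 => absurd (by simpa using h1) hh) ?_ hb
    intro t ht i ih hti
    by_cases h1 : h * t ∈ thompsonSemigroup
    · exact ih h1
    · exact ⟨t, ht, i, h1, by rwa [mul_assoc]⟩
  have hdn' : h * d * X i * (X i)⁻¹ ∉ thompsonSemigroup := by rwa [mul_inv_cancel_right]
  set k := d⁻¹ * h * d with hk
  -- Two of the conjugates of `k` by the powers of `X j` coincide.
  have hcomm : ∀ j ≠ i, ∃ n ≠ 0, Commute k (X j ^ n) := by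
    intro j hj
    have hmem : ∀ n : ℕ, (X j ^ n)⁻¹ * k * X j ^ n ∈ {x | ∃ s ∈ thompsonSemigroup,
        h * s ∉ thompsonSemigroup ∧ s⁻¹ * h * s = x} := fun n => by
      refine ⟨d * X j ^ n, mul_mem hd (pow_mem (X_mem j) n), ?_, by rw [hk]; group⟩
      have := mul_X_inv_mul_pow_notMem hdi hdn' hj n
      rwa [mul_inv_cancel_right, mul_assoc] at this
    obtain ⟨m, n, hmn, heq⟩ := Set.Finite.exists_lt_map_eq_of_forall_mem hmem hfin
    obtain ⟨l, rfl⟩ := Nat.exists_eq_add_of_lt hmn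
    refine ⟨l + 1, by omega, ?_⟩
    -- Cancelling the conjugation by `X j ^ m` leaves `k` equal to its conjugate by `X j ^ (l + 1)`.
    have h1 : (X j ^ m)⁻¹ * k * X j ^ m =
        (X j ^ m)⁻¹ * ((X j ^ (l + 1))⁻¹ * k * X j ^ (l + 1)) * X j ^ m := by
      rw [heq]
      group
    have h2 := mul_left_cancel (mul_right_cancel h1)
    rwa [mul_assoc, eq_inv_mul_iff_mul_eq, eq_comm] at h2
  obtain ⟨h1, h2⟩ := act_eq_of_commute hcomm
  refine hdn' (mul_X_inv_mem hdi ?_)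
  have h3 : h * d * X i = d * k * X i := by rw [hk]; group
  rw [h3, act_mul_apply, act_mul_apply, act_mul_apply _ (X i), act_mul_apply d, act_X,
    halve_of_le le_rfl, halve_of_mem (by linarith) le_rfl,
    show ((i : ℚ) + 2 + i) / 2 = i + 1 by ring, h1, h2]
  exact isStdDyadic_act hd i

/-! ### Circumcenters in Hilbert spaces -/

section Circumcenter

variable {E : Type*} [NormedAddCommGroup E] [InnerProductSpace ℝ E]

/-- The parallelogram law for the midpoint of `v` and `w`, seen from `o`. -/
theorem norm_sub_midpoint_sq_le {o v w : E} {r : ℝ} (hv : ‖o - v‖ ≤ r) (hw : ‖o - w‖ ≤ r) :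
    ‖o - (1 / 2 : ℝ) • (v + w)‖ ^ 2 ≤ r ^ 2 - ‖v - w‖ ^ 2 / 4 := by
  have h := parallelogram_law_with_norm ℝ (o - v) (o - w)
  have h1 : o - v + (o - w) = (2 : ℝ) • (o - (1 / 2 : ℝ) • (v + w)) := by module
  have h2 : o - v - (o - w) = -(v - w) := by abel
  rw [h1, h2, norm_neg, norm_smul, Real.norm_of_nonneg zero_le_two] at h
  have h3 := pow_le_pow_left₀ (norm_nonneg _) hv 2
  have h4 := pow_le_pow_left₀ (norm_nonneg _) hw 2
  nlinarith

/-- A nonempty bounded set in a Hilbert space is contained in a unique closed ball of minimal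
radius. -/
theorem exists_circumcenter [CompleteSpace E] {O : Set E} (hne : O.Nonempty)
    (hb : Bornology.IsBounded O) :
    ∃ (c : E) (r : ℝ), (∀ o ∈ O, ‖o - c‖ ≤ r) ∧ ∀ v, (∀ o ∈ O, ‖o - v‖ ≤ r) → v = c := by
  -- `R` is the infimum of the radii of the closed balls that contain `O`.
  set P : Set ℝ := {r | 0 ≤ r ∧ ∃ v, ∀ o ∈ O, ‖o - v‖ ≤ r}
  obtain ⟨o₀, ho₀⟩ := hne
  have hPne : P.Nonempty := by
    obtain ⟨r, hr⟩ := hb.exists_norm_le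
    exact ⟨r, (norm_nonneg _).trans (hr o₀ ho₀), 0, by simpa using hr⟩
  have hPb : BddBelow P := ⟨0, fun r hr => hr.1⟩
  set R := sInf P
  have hR0 : 0 ≤ R := le_csInf hPne fun r hr => hr.1
  have key : ∀ r v w, (∀ o ∈ O, ‖o - v‖ ≤ r) → (∀ o ∈ O, ‖o - w‖ ≤ r) →
      ‖v - w‖ ^ 2 ≤ 4 * (r ^ 2 - R ^ 2) := by
    intro r v w hv hw
    have h1 := fun o ho => norm_sub_midpoint_sq_le (hv o ho) (hw o ho)
    have h0 : 0 ≤ r ^ 2 - ‖v - w‖ ^ 2 / 4 := (sq_nonneg _).trans (h1 o₀ ho₀)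
    have h2 : R ≤ √(r ^ 2 - ‖v - w‖ ^ 2 / 4) := csInf_le hPb
      ⟨Real.sqrt_nonneg _, _, fun o ho => Real.le_sqrt_of_sq_le (h1 o ho)⟩
    have h3 := (Real.le_sqrt hR0 h0).1 h2
    linarith
  have hex : ∀ n : ℕ, ∃ v, ∀ o ∈ O, ‖o - v‖ ≤ R + 1 / (n + 1) := by
    intro n
    obtain ⟨r, ⟨-, v, hv⟩, hr⟩ := exists_lt_of_csInf_lt hPne
      (show sInf P < R + 1 / ((n : ℝ) + 1) from lt_add_of_pos_right _ (by positivity))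
    exact ⟨v, fun o ho => (hv o ho).trans hr.le⟩
  choose v hv using hex
  have ht : Tendsto (fun n : ℕ => R + 1 / ((n : ℝ) + 1)) atTop (𝓝 R) := by
    simpa using tendsto_const_nhds.add (tendsto_one_div_add_atTop_nhds_zero_nat (𝕜 := ℝ))
  have hcauchy : CauchySeq v := by
    refine cauchySeq_of_le_tendsto_0 (fun n : ℕ => √(4 * ((R + 1 / ((n : ℝ) + 1)) ^ 2 - R ^ 2)))
      (fun n m N hn hm => ?_) ?_
    · rw [dist_eq_norm]
      refine Real.le_sqrt_of_sq_le (key _ _ _ (fun o ho => (hv n o ho).trans ?_)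
        (fun o ho => (hv m o ho).trans ?_))
      · gcongr
      · gcongr
    · have := ((((ht.pow 2).sub_const (R ^ 2)).const_mul 4).sqrt)
      simpa using this
  obtain ⟨c, hc⟩ := cauchySeq_tendsto_of_complete hcauchy
  have hcR : ∀ o ∈ O, ‖o - c‖ ≤ R := fun o ho =>
    le_of_tendsto_of_tendsto' ((tendsto_const_nhds.sub hc).norm) ht fun n => hv n o ho
  refine ⟨c, R, hcR, fun w hw => ?_⟩
  have h := key R w c hw hcR
  rw [sub_self, mul_zero] at h
  exact sub_eq_zero.1 (norm_eq_zero.1 (pow_eq_zero_iff two_ne_zero |>.1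
    (le_antisymm h (sq_nonneg _))))

/-- The circumcenter of a bounded set lies in its closed convex hull and is fixed by every
isometry that maps the set into itself. -/
theorem exists_mem_closedConvexHull_fixed [CompleteSpace E] {O : Set E} (hne : O.Nonempty)
    (hb : Bornology.IsBounded O) :
    ∃ c ∈ closedConvexHull ℝ O, ∀ A : E ≃ᵢ E, Set.MapsTo A O O → A c = c := by
  obtain ⟨c, r, hc, huniq⟩ := exists_circumcenter hne hb
  refine ⟨c, ?_, fun A hA => ?_⟩
  · obtain ⟨p, hp, hmin⟩ := exists_norm_eq_iInf_of_complete_convex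
      (hne.mono (subset_closedConvexHull (𝕜 := ℝ)))
      (isClosed_closedConvexHull (𝕜 := ℝ) (s := O)).isComplete (convex_closedConvexHull) c
    rw [norm_eq_iInf_iff_real_inner_le_zero convex_closedConvexHull hp] at hmin
    -- Projecting to the hull does not increase the distance to any point of the set.
    have : p = c := huniq p fun o ho => by
      refine le_trans ?_ (hc o ho)
      have h1 := hmin o (subset_closedConvexHull ho)
      have h2 : ‖o - c‖ ^ 2 = ‖o - p‖ ^ 2 - 2 * inner ℝ (c - p) (o - p) + ‖c - p‖ ^ 2 := by
        rw [real_inner_comm, ← norm_sub_sq_real]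
        congr 2
        abel
      refine le_of_sq_le_sq ?_ (norm_nonneg _)
      nlinarith [sq_nonneg ‖c - p‖]
    exact this ▸ hp
  · have h : A.symm c = c := huniq _ fun o ho => by
      rw [← dist_eq_norm, ← A.dist_eq, A.apply_symm_apply, dist_eq_norm]
      exact hc _ (hA ho)
    rw [← h, A.apply_symm_apply, h]

end Circumcenter

/-! ### Reindexing and extension by zero on `ℓ²` -/

section Extend

variable {α β : Type*}

theorem hasSum_norm_extend (θ : α ↪ β) (f : L2 α) :
    HasSum (fun b => ‖Function.extend θ f 0 b‖ ^ (2 : ℝ)) (‖f‖ ^ (2 : ℝ)) := by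
  rw [← θ.injective.hasSum_iff fun b hb => by
    rw [Function.extend_apply' _ _ _ (by simpa using hb)]; simp]
  simpa [Function.comp_def, θ.injective.extend_apply] using
    lp.hasSum_norm (p := 2) (by norm_num) f

/-- The isometry `ℓ²(α) → ℓ²(β)` that moves functions along an embedding `θ` and extends them
by zero. -/
def extendL2 (θ : α ↪ β) : L2 α →ₗᵢ[ℂ] L2 β where
  toFun f := ⟨Function.extend θ f 0, memℓp_gen (by simpa using (hasSum_norm_extend θ f).summable)⟩
  map_add' f g := by
    ext b
    change Function.extend θ (fun a => f a + g a) 0 b =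
      Function.extend θ f 0 b + Function.extend θ g 0 b
    by_cases hb : ∃ a, θ a = b
    · obtain ⟨a, rfl⟩ := hb
      simp [θ.injective.extend_apply]
    · simp [Function.extend_apply' _ _ _ hb]
  map_smul' c f := by
    ext b
    change Function.extend θ (fun a => c * f a) 0 b = c * Function.extend θ f 0 b
    by_cases hb : ∃ a, θ a = b
    · obtain ⟨a, rfl⟩ := hb
      simp [θ.injective.extend_apply]
    · simp [Function.extend_apply' _ _ _ hb]
  norm_map' f := by
    have h := lp.hasSum_norm (p := 2) (by norm_num)
      (⟨Function.extend θ f 0, memℓp_gen (by simpa using (hasSum_norm_extend θ f).summable)⟩ : L2 β)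
    have h' := h.unique (by simpa using hasSum_norm_extend θ f)
    exact (Real.rpow_left_inj (z := 2) (norm_nonneg _) (norm_nonneg _) (by norm_num)).1
      (by simpa using h')

@[simp]
theorem extendL2_apply (θ : α ↪ β) (f : L2 α) (a : α) : extendL2 θ f (θ a) = f a :=
  θ.injective.extend_apply _ _ _

theorem extendL2_of_notMem (θ : α ↪ β) (f : L2 α) {b : β} (hb : ¬∃ a, θ a = b) :
    extendL2 θ f b = 0 :=
  Function.extend_apply' _ _ _ hb

theorem extendL2_delta (θ : α ↪ β) (a : α) : extendL2 θ (delta a) = delta (θ a) := by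
  classical
  ext b
  by_cases hb : ∃ x, θ x = b
  · obtain ⟨x, rfl⟩ := hb
    simp [delta, Pi.single_apply]
  · rw [extendL2_of_notMem _ _ hb]
    have : b ≠ θ a := fun h => hb ⟨a, h.symm⟩
    simp [delta, this]

theorem norm_delta (a : α) : ‖delta a‖ = 1 := by
  classical
  simp [delta, lp.norm_single]

theorem norm_sum_smul_delta_le (g : L2 α) (F : Finset α) : ‖∑ a ∈ F, g a • delta a‖ ≤ ‖g‖ := by
  classical
  have h : ∑ a ∈ F, g a • delta a = ∑ a ∈ F, lp.single 2 a (g a) :=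
    Finset.sum_congr rfl fun a _ => by
      rw [delta, ← lp.single_smul, smul_eq_mul, mul_one]
  have h1 := lp.norm_sum_single (p := 2) (by norm_num) g F
  have h2 := lp.sum_rpow_le_norm_rpow (p := 2) (by norm_num) g F
  rw [← h1, ← h] at h2
  exact (Real.rpow_le_rpow_iff (norm_nonneg _) (norm_nonneg _) (by norm_num)).1 h2

theorem clm_ext_delta {E : Type*} [NormedAddCommGroup E] [NormedSpace ℂ E] {T U : L2 α →L[ℂ] E}
    (h : ∀ a, T (delta a) = U (delta a)) : T = U := by
  classical
  refine lp.ext_continuousLinearMap (by norm_num) fun a => ?_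
  ext
  simpa [delta] using h a

end Extend

/-! ### Translations on `ℓ²` of a group and of a submonoid -/

section Group

variable {G : Type*} [Group G]

/-- Right translation, `v ↦ v * δ_t`. -/
def rightTrans (t : G) : L2 G →ₗᵢ[ℂ] L2 G := extendL2 (Equiv.mulRight t).toEmbedding

theorem rightTrans_apply (t : G) (v : L2 G) (x : G) : rightTrans t v x = v (x * t⁻¹) := by
  have := extendL2_apply (Equiv.mulRight t).toEmbedding v (x * t⁻¹)
  rwa [show (Equiv.mulRight t).toEmbedding (x * t⁻¹) = x by simp] at this

/-- Conjugation, `v ↦ δ_s * v * δ_{s⁻¹}`. -/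
def conjL2 (s : G) : L2 G →ₗᵢ[ℂ] L2 G := extendL2 (MulAut.conj s).toEquiv.toEmbedding

theorem conjL2_apply (s : G) (v : L2 G) (x : G) : conjL2 s v x = v (s⁻¹ * x * s) := by
  have := extendL2_apply (MulAut.conj s).toEquiv.toEmbedding v (s⁻¹ * x * s)
  rwa [show (MulAut.conj s).toEquiv.toEmbedding (s⁻¹ * x * s) = x by simp [mul_assoc]] at this

theorem conjL2_surjective (s : G) : Function.Surjective (conjL2 s) := fun v => by
  refine ⟨conjL2 s⁻¹ v, ?_⟩
  ext x
  rw [conjL2_apply, conjL2_apply]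
  group

/-- The isometry `v ↦ δ_s * v * δ_{s⁻¹} + w`. -/
def affineConj (s : G) (w : L2 G) : L2 G ≃ᵢ L2 G :=
  (LinearIsometryEquiv.ofSurjective (conjL2 s) (conjL2_surjective s)).toIsometryEquiv.trans
    (IsometryEquiv.addRight w)

theorem affineConj_apply (s : G) (w v : L2 G) : affineConj s w v = conjL2 s v + w := rfl

variable (S : Submonoid G)

/-- The inclusion `ℓ²(S) ⊆ ℓ²(G)`. -/
def incl : L2 S →ₗᵢ[ℂ] L2 G := extendL2 (Function.Embedding.subtype _)

variable {S}

@[simp]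
theorem incl_coe (f : L2 S) (s : S) : incl S f (s : G) = f s :=
  extendL2_apply (Function.Embedding.subtype _) f s

theorem incl_of_mem (f : L2 S) {x : G} (hx : x ∈ S) : incl S f x = f ⟨x, hx⟩ := incl_coe f ⟨x, hx⟩

theorem incl_of_notMem (f : L2 S) {x : G} (hx : x ∉ S) : incl S f x = 0 :=
  extendL2_of_notMem _ _ (by rintro ⟨a, rfl⟩; exact hx a.2)

theorem incl_injective : Function.Injective (incl S) := (incl S).injective

theorem exists_incl_eq {v : L2 G} (hv : ∀ x ∉ S, v x = 0) : ∃ f : L2 S, incl S f = v := by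
  have hmem : Memℓp (fun s : S => v s) 2 := memℓp_gen (by
    simpa [Function.comp_def] using (summable_sq v).comp_injective Subtype.val_injective)
  refine ⟨⟨fun s : S => v s, hmem⟩, ?_⟩
  ext x
  by_cases hx : x ∈ S
  · exact incl_of_mem _ hx
  · rw [incl_of_notMem _ hx, hv x hx]

theorem incl_leftReg (s : S) (g : L2 S) (x : G) :
    incl S (leftReg s g) x = incl S g ((s : G)⁻¹ * x) := by
  by_cases hx : (s : G)⁻¹ * x ∈ S
  · obtain ⟨y, rfl⟩ : ∃ y : S, x = ((s * y : S) : G) := ⟨⟨_, hx⟩, by simp⟩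
    rw [incl_coe, Submonoid.coe_mul, inv_mul_cancel_left, incl_coe]
    exact conv_delta_mul s g y
  · rw [incl_of_notMem _ hx]
    by_cases hxS : x ∈ S
    · rw [incl_of_mem _ hxS]
      refine conv_delta_of_notMem s g _ ?_
      rintro ⟨y, hy⟩
      refine hx ?_
      have : (s : G) * y = x := congrArg Subtype.val hy
      rw [← this, inv_mul_cancel_left]
      exact y.2
    · exact incl_of_notMem _ hxS

theorem leftReg_delta (s t : S) : leftReg s (delta t) = delta (s * t) := by
  classical
  refine incl_injective ?_
  ext x
  rw [incl_leftReg, incl, extendL2_delta, extendL2_delta]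
  simp [delta, Pi.single_apply, inv_mul_eq_iff_eq_mul]

theorem leftReg_mul (s t : S) : (leftReg (s * t)).toContinuousLinearMap =
    (leftReg s).toContinuousLinearMap * (leftReg t).toContinuousLinearMap :=
  clm_ext_delta fun a => by simp [leftReg_delta, mul_assoc]

/-- Convolution on the submonoid as a sum over the second factor. -/
theorem hasSum_conv (f g : L2 S) (y : S) :
    HasSum (fun t : S => incl S f ((y : G) * (t : G)⁻¹) * g t) (conv f g y) := by
  have hinj : Function.Injective fun p : {p : S × S // p.1 * p.2 = y} => p.1.2 := by
    rintro ⟨⟨a, b⟩, h⟩ ⟨⟨c, d⟩, h'⟩ (rfl : b = d)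
    obtain rfl : a = c := mul_right_cancel (h.trans h'.symm)
    rfl
  rw [← hinj.hasSum_iff]
  · refine (summable_conv f g y).hasSum.congr_fun ?_
    rintro ⟨⟨a, b⟩, rfl⟩
    simp
  · intro t ht
    rw [incl_of_notMem, zero_mul]
    intro hmem
    exact ht ⟨⟨(⟨_, hmem⟩, t), Subtype.ext (by simp)⟩, rfl⟩

theorem IsLeftConv.incl_apply_delta {f : L2 S} {T : L2 S →L[ℂ] L2 S} (h : IsLeftConv f T) (t : S)
    (x : G) : incl S (T (delta t)) x = incl S f (x * (t : G)⁻¹) := by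
  classical
  by_cases hx : x ∈ S
  · rw [incl_of_mem _ hx, h]
    refine (hasSum_conv f (delta t) ⟨x, hx⟩).unique ?_
    convert hasSum_ite_eq t (incl S f (x * (t : G)⁻¹)) using 2 with u
    by_cases hu : u = t <;> simp [delta, hu]
  · rw [incl_of_notMem _ hx, incl_of_notMem]
    intro hmem
    exact hx (by simpa using mul_mem hmem t.2)

/-- Convolution operators commute with right translations. -/
theorem incl_apply_delta_of_mem_convAlg {T : L2 S →L[ℂ] L2 S} (h : T ∈ convAlg S) (t : S)
    (x : G) : incl S (T (delta t)) x = incl S (T (delta 1)) (x * (t : G)⁻¹) := by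
  obtain ⟨f, hf⟩ := h
  rw [hf.incl_apply_delta, hf.incl_apply_delta]
  simp

/-- If `g ↦ f * g` is bounded on finitely supported functions, then `f` is the symbol of a bounded
convolution operator. -/
theorem exists_isLeftConv_of_bound {f : L2 S} {M : ℝ}
    (hM : ∀ (F : Finset S) (g : S → ℂ), ‖∑ t ∈ F, g t • rightTrans (t : G) (incl S f)‖ ≤
      M * ‖∑ t ∈ F, g t • delta t‖) :
    ∃ T : L2 S →L[ℂ] L2 S, IsLeftConv f T := by
  have hM0 : 0 ≤ M := by
    have h := (norm_nonneg _).trans (hM {1} 1)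
    simpa [norm_delta] using h
  have key : ∀ (g : L2 S) (K : Finset S),
      ∑ y ∈ K, ‖conv f g y‖ ^ (2 : ℝ) ≤ (M * ‖g‖) ^ (2 : ℝ) := by
    intro g K
    have ht : Tendsto (fun F : Finset S => ∑ y ∈ K,
        ‖∑ t ∈ F, incl S f ((y : G) * (t : G)⁻¹) * g t‖ ^ (2 : ℝ)) atTop
        (𝓝 (∑ y ∈ K, ‖conv f g y‖ ^ (2 : ℝ))) :=
      tendsto_finsetSum _ fun y _ => (hasSum_conv f g y).norm.rpow_const (Or.inr (by norm_num))
    refine le_of_tendsto' ht fun F => ?_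
    set v : L2 G := ∑ t ∈ F, g t • rightTrans (t : G) (incl S f) with hv
    have hvy : ∀ y : G, v y = ∑ t ∈ F, incl S f (y * (t : G)⁻¹) * g t := fun y => by
      rw [hv, lp.coeFn_sum, Finset.sum_apply]
      exact Finset.sum_congr rfl fun t _ => by
        rw [lp.coeFn_smul, Pi.smul_apply, rightTrans_apply, smul_eq_mul, mul_comm]
    have h1 := lp.sum_rpow_le_norm_rpow (p := 2) (by norm_num) v
      (K.map (Function.Embedding.subtype _))
    rw [Finset.sum_map] at h1
    have h2 : ‖v‖ ≤ M * ‖g‖ := (hM F g).trans (by gcongr; exact norm_sum_smul_delta_le g F)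
    calc _ = ∑ y ∈ K, ‖v y‖ ^ (2 : ℝ) := Finset.sum_congr rfl fun y _ => by rw [hvy]
      _ ≤ ‖v‖ ^ (2 : ℝ) := by simpa using h1
      _ ≤ _ := by gcongr
  have hmem : ∀ g : L2 S, Memℓp (conv f g) 2 := fun g => memℓp_gen' (by simpa using key g)
  refine ⟨LinearMap.mkContinuous
    { toFun := fun g => (⟨conv f g, hmem g⟩ : L2 S)
      map_add' := fun g h => ?_
      map_smul' := fun c g => ?_ } M fun g => ?_, fun g s => rfl⟩
  · ext y
    refine (hasSum_conv f (g + h) y).unique ?_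
    change HasSum _ (conv f g y + conv f h y)
    simpa [mul_add] using (hasSum_conv f g y).add (hasSum_conv f h y)
  · ext y
    refine (hasSum_conv f (c • g) y).unique ?_
    change HasSum _ (c * conv f g y)
    simpa [mul_left_comm] using (hasSum_conv f g y).mul_left c
  · exact lp.norm_le_of_forall_sum_le (p := 2) (by norm_num) (by positivity)
      (by simpa using key g)

end Group

/-! ### Derivations of a generated Banach algebra -/

section Generators

variable {A : Type*} [NormedRing A] [NormedAlgebra ℂ A]

theorem exists_norm_le_mul_norm {B : Subalgebra ℂ A} {L : Submodule ℂ A} (D : B →L[ℂ] L) :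
    ∃ M : ℝ, 0 ≤ M ∧ ∀ T : B, ‖(D T : A)‖ ≤ M * ‖(T : A)‖ :=
  ⟨‖D‖, norm_nonneg D, D.le_opNorm⟩

theorem subsingleton_H1 {B : Subalgebra ℂ A} {L : Submodule ℂ A}
    (h : ∀ D ∈ Z1 B L, ∃ C ∈ L, ∀ T : B, (D T : A) = C * T - T * C) : Subsingleton (H1 B L) := by
  rw [QuotientAddGroup.subsingleton_iff, eq_top_iff]
  rintro ⟨D, hD⟩ -
  obtain ⟨C, hC, h⟩ := h D hD
  refine ⟨-C, neg_mem hC, fun T => (h T).trans ?_⟩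
  noncomm_ring

/-- A commutator with `C` that agrees with a continuous derivation on a set agrees with it on the
Banach algebra generated by that set. -/
theorem eq_commutator_of_generators {s : Set A} {L : Submodule ℂ A}
    {D : (Algebra.adjoin ℂ s).topologicalClosure →L[ℂ] L}
    (hD : D ∈ Z1 (Algebra.adjoin ℂ s).topologicalClosure L) {C : A}
    (hC : ∀ T : (Algebra.adjoin ℂ s).topologicalClosure, (T : A) ∈ s → (D T : A) = C * T - T * C)
    (T : (Algebra.adjoin ℂ s).topologicalClosure) : (D T : A) = C * T - T * C := by
  have hclosed : IsClosed {T : (Algebra.adjoin ℂ s).topologicalClosure |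
      (D T : A) = C * T - T * C} :=
    isClosed_eq (continuous_subtype_val.comp D.continuous)
      ((continuous_const.mul continuous_subtype_val).sub
        (continuous_subtype_val.mul continuous_const))
  have hle := Subalgebra.le_topologicalClosure (Algebra.adjoin ℂ s)
  have hmem : ∀ T (hT : T ∈ Algebra.adjoin ℂ s), (D ⟨T, hle hT⟩ : A) = C * T - T * C := by
    intro T hT
    induction hT using Algebra.adjoin_induction with
    | mem x hx => exact hC _ hx
    | algebraMap r =>
      have h1 : (D 1 : A) = 0 := by simpa using hD 1 1
      have h2 : (⟨algebraMap ℂ A r, hle (algebraMap_mem _ r)⟩ :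
          (Algebra.adjoin ℂ s).topologicalClosure) = r • 1 :=
        Subtype.ext (Algebra.algebraMap_eq_smul_one r)
      rw [h2, map_smul, Submodule.coe_smul, h1, smul_zero, Algebra.commutes, sub_self]
    | add x y hx hy h1 h2 =>
      have h3 : (⟨x + y, hle (add_mem hx hy)⟩ : (Algebra.adjoin ℂ s).topologicalClosure) =
        ⟨x, hle hx⟩ + ⟨y, hle hy⟩ := rfl
      rw [h3, map_add, Submodule.coe_add, h1, h2]
      noncomm_ring
    | mul x y hx hy h1 h2 =>
      have h3 : (⟨x * y, hle (mul_mem hx hy)⟩ : (Algebra.adjoin ℂ s).topologicalClosure) =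
        ⟨x, hle hx⟩ * ⟨y, hle hy⟩ := rfl
      rw [h3, hD, h1, h2]
      noncomm_ring
  have hT : T ∈ closure {T : (Algebra.adjoin ℂ s).topologicalClosure |
      (T : A) ∈ Algebra.adjoin ℂ s} := by
    rw [closure_subtype]
    refine closure_mono ?_ T.2
    exact fun x hx => ⟨⟨x, hle hx⟩, hx, rfl⟩
  exact hclosed.closure_subset_iff.2 (fun x hx => hmem x hx) hT

end Generators

/-! ### Derivations of the regular algebra of a submonoid -/

section Derivation

variable {G : Type*} [Group G] {S : Submonoid G}

/-- The operator `L_s` as an element of the Banach algebra `𝔅(S)`. -/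
def reg (s : S) : regAlg S :=
  ⟨(leftReg s).toContinuousLinearMap,
    Subalgebra.le_topologicalClosure _ (Algebra.subset_adjoin ⟨s, rfl⟩)⟩

theorem reg_mul (s t : S) : reg (s * t) = reg s * reg t := Subtype.ext (leftReg_mul s t)

theorem coe_reg_apply (s : S) (g : L2 S) :
    (reg s : L2 S →L[ℂ] L2 S) g = leftReg s g := rfl

variable (D : regAlg S →L[ℂ] convAlg S)

/-- The image of `L_s` under `D`, as an operator. -/
def derivOp (s : S) : L2 S →L[ℂ] L2 S := D (reg s)

theorem derivOp_mem (s : S) : derivOp D s ∈ convAlg S := (D (reg s)).2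

theorem exists_norm_derivOp_le : ∃ M : ℝ, ∀ s, ‖derivOp D s‖ ≤ M := by
  obtain ⟨M, hM0, hM⟩ := exists_norm_le_mul_norm D
  exact ⟨M, fun s => (hM (reg s)).trans
    (mul_le_of_le_one_right hM0 (leftReg s).norm_toContinuousLinearMap_le)⟩

/-- The function `f_s * δ_{s⁻¹}` in `ℓ²(G)`, where `f_s` is the symbol of `D (L_s)`. -/
def cocycle (s : S) : L2 G := rightTrans (s : G)⁻¹ (incl S (derivOp D s (delta 1)))

theorem cocycle_apply (s : S) (x : G) :
    cocycle D s x = incl S (derivOp D s (delta 1)) (x * s) := by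
  rw [cocycle, rightTrans_apply, inv_inv]

variable {D} {M : ℝ}

theorem norm_cocycle_le (hM : ∀ s, ‖derivOp D s‖ ≤ M) (s : S) : ‖cocycle D s‖ ≤ M := by
  rw [cocycle, LinearIsometry.norm_map, LinearIsometry.norm_map]
  simpa [norm_delta] using (derivOp D s).le_of_opNorm_le (hM s) (delta 1)

theorem affineConj_cocycle (hD : D ∈ Z1 (regAlg S) (convAlg S)) (s t : S) :
    affineConj (s : G) (cocycle D s) (cocycle D t) = cocycle D (s * t) := by
  have h : derivOp D (s * t) (delta 1) =
      leftReg s (derivOp D t (delta 1)) + derivOp D s (delta t) := by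
    have h1 := hD (reg s) (reg t)
    rw [← reg_mul] at h1
    have h2 := congrArg (fun T : L2 S →L[ℂ] L2 S => T (delta 1)) h1
    simp only [add_apply, mul_apply_eq_comp, coe_reg_apply, leftReg_delta,
      mul_one] at h2
    exact h2
  rw [affineConj_apply]
  ext x
  rw [lp.coeFn_add, Pi.add_apply, conjL2_apply, cocycle_apply, cocycle_apply, cocycle_apply, h,
    map_add, lp.coeFn_add, Pi.add_apply, incl_leftReg,
    incl_apply_delta_of_mem_convAlg (derivOp_mem D s) t]
  simp [mul_assoc]

/-- The cocycle is the coboundary of a vector of `ℓ²(G)` in its closed convex hull, the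
circumcenter of its range. -/
theorem exists_coboundary (hD : D ∈ Z1 (regAlg S) (convAlg S)) (hM : ∀ s, ‖derivOp D s‖ ≤ M) :
    ∃ c ∈ closedConvexHull ℝ (Set.range (cocycle D)), ∀ (s : S) (x : G),
      cocycle D s x = c x - c ((s : G)⁻¹ * x * s) := by
  obtain ⟨c, hc, hfix⟩ := exists_mem_closedConvexHull_fixed (Set.range_nonempty (cocycle D))
    (isBounded_iff_forall_norm_le.2 ⟨M, by rintro _ ⟨s, rfl⟩; exact norm_cocycle_le hM s⟩)
  refine ⟨c, hc, fun s x => ?_⟩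
  have h := hfix (affineConj (s : G) (cocycle D s)) (by
    rintro _ ⟨t, rfl⟩
    exact ⟨s * t, (affineConj_cocycle hD s t).symm⟩)
  rw [affineConj_apply] at h
  have h' : conjL2 (s : G) c x + cocycle D s x = c x := by
    conv_rhs => rw [← h]
    rfl
  rw [conjL2_apply] at h'
  rw [← h', add_sub_cancel_left]

/-- Finitely many elements of `G` have a common right denominator. -/
theorem exists_common_denominator (hS : ∀ g : G, ∃ b ∈ S, g * b ∈ S) (F : Finset S) (g : S → G) :
    ∃ u ∈ S, ∀ t ∈ F, g t * u ∈ S := by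
  classical
  induction F using Finset.induction_on with
  | empty => exact ⟨1, one_mem _, by simp⟩
  | insert a F _ ih =>
    obtain ⟨u, hu, h⟩ := ih
    obtain ⟨b, hb, hab⟩ := hS (g a * u)
    refine ⟨u * b, mul_mem hu hb, fun t ht => ?_⟩
    rw [← mul_assoc]
    rcases Finset.mem_insert.1 ht with rfl | ht
    · exact hab
    · exact mul_mem (h t ht) hb

/-- Convolution by the cocycle is bounded on finitely supported functions: translating by a common
right denominator of `s⁻¹ * t`, for `t` in the support, reduces this to the boundedness
of `D (L_s)` on `ℓ²(S)`. -/
theorem norm_sum_smul_rightTrans_cocycle_le (hM : ∀ s, ‖derivOp D s‖ ≤ M)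
    (hS : ∀ g : G, ∃ b ∈ S, g * b ∈ S) (s : S)
    (F : Finset S) (g : S → ℂ) :
    ‖∑ t ∈ F, g t • rightTrans (t : G) (cocycle D s)‖ ≤ M * ‖∑ t ∈ F, g t • delta t‖ := by
  obtain ⟨u, -, hu⟩ := exists_common_denominator hS F fun t => (s : G)⁻¹ * t
  have hex : ∀ t : S, ∃ x : S, t ∈ F → (x : G) = (s : G)⁻¹ * t * u := fun t => by
    by_cases ht : t ∈ F
    · exact ⟨⟨_, hu t ht⟩, fun _ => rfl⟩
    · exact ⟨1, fun h => absurd h ht⟩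
  choose θ hθ using hex
  let κ : S ↪ G := ⟨fun t => (s : G)⁻¹ * t * u, fun a b h => by simpa using h⟩
  have h1 : ‖∑ t ∈ F, g t • delta (θ t)‖ = ‖∑ t ∈ F, g t • delta t‖ := by
    rw [← (incl S).norm_map, ← (extendL2 κ).norm_map, map_sum, map_sum]
    refine congrArg _ (Finset.sum_congr rfl fun t ht => ?_)
    rw [map_smul, map_smul, extendL2_delta, incl, extendL2_delta]
    congr 2
    exact hθ t ht
  have h2 : rightTrans u (∑ t ∈ F, g t • rightTrans (t : G) (cocycle D s)) =
      incl S (derivOp D s (∑ t ∈ F, g t • delta (θ t))) := by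
    simp only [map_sum, map_smul]
    refine Finset.sum_congr rfl fun t ht => ?_
    congr 1
    ext x
    rw [rightTrans_apply, rightTrans_apply, cocycle_apply,
      incl_apply_delta_of_mem_convAlg (derivOp_mem D s) (θ t), hθ t ht]
    group
  rw [← (rightTrans u).norm_map, h2, LinearIsometry.norm_map, ← h1]
  exact (derivOp D s).le_of_opNorm_le (hM s) _

theorem norm_sum_smul_rightTrans_le (hM : ∀ s, ‖derivOp D s‖ ≤ M)
    (hS : ∀ g : G, ∃ b ∈ S, g * b ∈ S) {c : L2 G}
    (hc : c ∈ closedConvexHull ℝ (Set.range (cocycle D))) (F : Finset S) (g : S → ℂ) :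
    ‖∑ t ∈ F, g t • rightTrans (t : G) c‖ ≤ M * ‖∑ t ∈ F, g t • delta t‖ := by
  set Φ : L2 G →L[ℂ] L2 G := ∑ t ∈ F, g t • (rightTrans (t : G)).toContinuousLinearMap with hΦ
  have hΦv : ∀ v, Φ v = ∑ t ∈ F, g t • rightTrans (t : G) v := fun v => by
    simp [hΦ]
  have hsub : closedConvexHull ℝ (Set.range (cocycle D)) ⊆
      (Φ.restrictScalars ℝ) ⁻¹' Metric.closedBall 0 (M * ‖∑ t ∈ F, g t • delta t‖) := by
    refine closedConvexHull_min ?_ ?_ ?_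
    · rintro _ ⟨s, rfl⟩
      rw [Set.mem_preimage, mem_closedBall_zero_iff, ContinuousLinearMap.coe_restrictScalars', hΦv]
      exact norm_sum_smul_rightTrans_cocycle_le hM hS s F g
    · exact (convex_closedBall _ _).linear_preimage (Φ.restrictScalars ℝ).toLinearMap
    · exact Metric.isClosed_closedBall.preimage (Φ.restrictScalars ℝ).continuous
  have := hsub hc
  rwa [Set.mem_preimage, mem_closedBall_zero_iff, ContinuousLinearMap.coe_restrictScalars',
    hΦv] at this

/-- A square summable function takes a nonzero value only finitely often. -/
theorem finite_setOf_apply_eq {α : Type*} (v : L2 α) {z : ℂ} (hz : z ≠ 0) :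
    {x | v x = z}.Finite := by
  have h := (summable_sq v).tendsto_cofinite_zero
  have hpos : 0 < ‖z‖ ^ (2 : ℝ) := by positivity
  have h1 := h.eventually (gt_mem_nhds hpos)
  refine (Filter.eventually_cofinite.1 h1).subset fun x hx => ?_
  have hx' : v x = z := hx
  exact fun hlt => (hx' ▸ hlt).false

/-- If `G` consists of right fractions of `S` and elements outside `S` have infinitely many
conjugates as in `infinite_conj`, then every continuous derivation `𝔅(S) → ℒ(S)` is inner. -/
theorem exists_eq_commutator (hS : ∀ g : G, ∃ b ∈ S, g * b ∈ S)
    (hconj : ∀ h ∉ S, {x | ∃ s ∈ S, h * s ∉ S ∧ s⁻¹ * h * s = x}.Infinite)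
    (hD : D ∈ Z1 (regAlg S) (convAlg S)) :
    ∃ C ∈ convAlg S, ∀ T : regAlg S, (D T : L2 S →L[ℂ] L2 S) = C * T - T * C := by
  obtain ⟨M, hM⟩ := exists_norm_derivOp_le D
  obtain ⟨c, hc, hcob⟩ := exists_coboundary hD hM
  have hsupp : ∀ h ∉ S, c h = 0 := by
    intro h hh
    by_contra hne
    refine hconj h hh ((finite_setOf_apply_eq c hne).subset ?_)
    rintro _ ⟨s, hs, hhs, rfl⟩
    have h1 := hcob ⟨s, hs⟩ h
    rw [cocycle_apply, incl_of_notMem _ hhs] at h1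
    exact (sub_eq_zero.1 h1.symm).symm
  obtain ⟨f, rfl⟩ := exists_incl_eq hsupp
  obtain ⟨C, hC⟩ := exists_isLeftConv_of_bound fun F g => norm_sum_smul_rightTrans_le hM hS hc F g
  refine ⟨C, ⟨f, hC⟩, eq_commutator_of_generators hD ?_⟩
  rintro ⟨_, hT⟩ ⟨s, rfl⟩
  change derivOp D s = _
  refine clm_ext_delta fun t => ?_
  refine incl_injective ?_
  ext x
  have h1 := hcob s (x * (s * t : G)⁻¹)
  rw [cocycle_apply] at h1
  have h2 : incl S ((C * (leftReg s).toContinuousLinearMap -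
      (leftReg s).toContinuousLinearMap * C) (delta t)) x =
      incl S (C (delta (s * t))) x - incl S (leftReg s (C (delta t))) x := by
    rw [← leftReg_delta]
    simp
  rw [h2, incl_apply_delta_of_mem_convAlg (derivOp_mem D s), hC.incl_apply_delta, incl_leftReg,
    hC.incl_apply_delta]
  rw [show x * ((s * t : S) : G)⁻¹ = x * (s * t : G)⁻¹ by simp,
    show (s : G)⁻¹ * x * (t : G)⁻¹ = (s : G)⁻¹ * (x * (s * t : G)⁻¹) * s by group, ← h1]
  group

end Derivation

end Thompson

end

theorem mainTheorem1 :
    Subsingleton (Thompson.H1 (Thompson.regAlg Thompson.thompsonSemigroup)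
      (Thompson.convAlg Thompson.thompsonSemigroup)) ∧
    ∀ D : Thompson.regAlg Thompson.thompsonSemigroup →L[ℂ]
        Thompson.convAlg Thompson.thompsonSemigroup,
      D ∈ Thompson.Z1 (Thompson.regAlg Thompson.thompsonSemigroup)
        (Thompson.convAlg Thompson.thompsonSemigroup) →
      ∃ C ∈ Thompson.convAlg Thompson.thompsonSemigroup,
        ∀ T : Thompson.regAlg Thompson.thompsonSemigroup,
          (D T : Thompson.L2 Thompson.thompsonSemigroup →L[ℂ]
            Thompson.L2 Thompson.thompsonSemigroup) = C * T - T * C := by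
  have key := fun (D : Thompson.regAlg Thompson.thompsonSemigroup →L[ℂ]
      Thompson.convAlg Thompson.thompsonSemigroup) hD =>
    Thompson.exists_eq_commutator (D := D) Thompson.exists_mul_mem
      (fun _ => Thompson.infinite_conj) hD
  exact ⟨Thompson.subsingleton_H1 key, key⟩
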